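/- Let $m,n\ge 1$ be coprime integers, not both equal to $1$. Let $G$ be the Baumslag–Solitar group $BS(m,n)=\langle a,t\mid ta^mt^{-1}=a^n\rangle$, acting by left multiplication on its Bass–Serre tree $\mathcal T$, whose vertices are the left cosets $g\langle a\rangle$ and whose edges join $g\langle a\rangle$ to $gt\langle a\rangle$ ($g\in G$); we identify $G$ with its image in $\mathrm{Aut}(\mathcal T)$. Give $\mathrm{Aut}(\mathcal T)$ the topology with basis the sets $\{y : y.v=x.v \text{ for all } v\in F\}$, where $x\in\mathrm{Aut}(\mathcal T)$ and $F$ is a finite set of vertices. For a subgroup $H\le\mathrm{Aut}(\mathcal T)$ and an integer $k\ge 0$, put $F_{k,e}=\mathrm{Fix}_H(B(v,k)\cap B(w,k))$ for each edge $e=(v,w)$, where $B(v,k)$ is the closed ball of radius $k$ around $v$ and $\mathrm{Fix}$ denotes the pointwise fixator. Let $\mathcal T_{(v,w)}$ be the component containing $w$ of $\mathcal T$ with the edge $e$ removed. Then: - $H$ has Property $P^{(k)}$ if $F_{k,e}=\mathrm{Fix}_{F_{k,e}}(\mathcal T_{(v,w)})\,\mathrm{Fix}_{F_{k,e}}(\mathcal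 T_{(w,v)})$ for every edge $e=(v,w)$; - the $k$-closure $H^{(k)}$ is the group of all $x\in\mathrm{Aut}(\mathcal T)$ such that for every vertex $v$ some $h\in H$ agrees with $x$ on $B(v,k)$; - $H^{+_k}$ is the subgroup generated by all the groups $F_{k,e}$, where $e$ runs over the edges of $\mathcal T$. Then: 1. $G$ does not satisfy Property $P^{(k)}$ for any integer $k\ge 0$. 2. Among the groups $(G^{(k)})^{+_k}$, $k\ge 1$, there are infinitely many distinct subgroups of $\mathrm{Aut}(\mathcal T)$, and each of these groups is non-discrete. 3. If moreover $m,n\ge 2$, then $(G^{(k)})^{+_k}$ is (abstractly) simple for every $k\ge 1$. Hence there are infinitely many distinct non-discrete simple groups of the form $(G^{(k)})^{+_k}$. -/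

import Mathlib

/-! Groups of automorphisms of a graph: closed balls, half-trees, fixators, the permutation
topology, `k`-closures, the independence property `P^(k)` and the subgroup `G^{+_k}`. -/

open scoped Pointwise

namespace TreeAut

variable {V : Type*} (T : SimpleGraph V)

/-- The vertex set of the closed ball `B(v, k)`: the vertices joined to `v` by a walk of length
at most `k`. -/
def ball (v : V) (k : ℕ) : Set V := {u | ∃ p : T.Walk v u, p.length ≤ k}

/-- The vertex set of the semi-tree `T_(v,w)`: the connected component containing `w` of the graph
obtained from `T` by deleting the edge between `v` and `w`. -/
def semitree (v w : V) : Set V := {u | (T.deleteEdges {s(v, w)}).Reachable w u}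

/-- The topology on `Aut(T)` whose basic open sets are the sets
`{y | y v = x v for all v ∈ F}` for `x ∈ Aut(T)` and `F` a finite set of vertices. -/
instance autTopology : TopologicalSpace (T ≃g T) :=
  TopologicalSpace.generateFrom
    {U | ∃ (x : T ≃g T) (F : Finset V), U = {y | ∀ v ∈ F, y v = x v}}

variable {T}

/-- The pointwise fixator in `G` of a set `S` of vertices. -/
def fixator (G : Subgroup (T ≃g T)) (S : Set V) : Subgroup (T ≃g T) where
  carrier := {g | g ∈ G ∧ ∀ v ∈ S, g v = v}
  one_mem' := ⟨G.one_mem, fun _ _ => rfl⟩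
  mul_mem' := by
    rintro g h ⟨hg, hg'⟩ ⟨hh, hh'⟩
    refine ⟨G.mul_mem hg hh, fun v hv => ?_⟩
    rw [RelIso.mul_apply, hh' v hv, hg' v hv]
  inv_mem' := by
    rintro g ⟨hg, hg'⟩
    refine ⟨G.inv_mem hg, fun v hv => ?_⟩
    have h := RelIso.inv_apply_self g v
    rwa [hg' v hv] at h

theorem map_mem_ball (x : T ≃g T) {v u : V} {k : ℕ} (h : u ∈ ball T v k) :
    x u ∈ ball T (x v) k := by
  obtain ⟨p, hp⟩ := h
  exact ⟨p.map x.toHom, by simpa using hp⟩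

/-- The `k`-closure `G^(k)`: all automorphisms of `T` which on every ball of radius `k` agree with
some element of `G`. -/
def kClosure (G : Subgroup (T ≃g T)) (k : ℕ) : Subgroup (T ≃g T) where
  carrier := {x | ∀ v, ∃ g ∈ G, ∀ u ∈ ball T v k, g u = x u}
  one_mem' := fun _ => ⟨1, G.one_mem, fun _ _ => rfl⟩
  mul_mem' := by
    intro y x hy hx v
    obtain ⟨g, hg, hgx⟩ := hx v
    obtain ⟨h, hh, hhy⟩ := hy (x v)
    refine ⟨h * g, G.mul_mem hh hg, fun u hu => ?_⟩
    rw [RelIso.mul_apply, RelIso.mul_apply, hgx u hu, hhy (x u) (map_mem_ball x hu)]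
  inv_mem' := by
    intro x hx v
    obtain ⟨g, hg, hgx⟩ := hx (x⁻¹ v)
    refine ⟨g⁻¹, G.inv_mem hg, fun u hu => ?_⟩
    have h := hgx (x⁻¹ u) (map_mem_ball x⁻¹ hu)
    rw [RelIso.apply_inv_self] at h
    rw [← RelIso.inv_apply_self g (x⁻¹ u), h]

/-- The group `F_{k,e} = Fix_G(B(v,k) ∩ B(w,k))` for the edge `e = (v, w)`. -/
def edgeFixator (G : Subgroup (T ≃g T)) (k : ℕ) (v w : V) : Subgroup (T ≃g T) :=
  fixator G (ball T v k ∩ ball T w k)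

/-- Property `P^(k)`: for every edge `e = (v, w)`, the group `F_{k,e}` is the product set of the
fixators in `F_{k,e}` of the two semi-trees `T_(v,w)` and `T_(w,v)`. -/
def PropertyP (G : Subgroup (T ≃g T)) (k : ℕ) : Prop :=
  ∀ v w : V, T.Adj v w →
    (edgeFixator G k v w : Set (T ≃g T)) =
      (fixator (edgeFixator G k v w) (semitree T v w) : Set (T ≃g T)) *
        (fixator (edgeFixator G k v w) (semitree T w v) : Set (T ≃g T))

/-- The subgroup `G^{+_k}` generated by all elements of `G` that fix `B(v,k) ∩ B(w,k)` for some
edge `(v, w)`. -/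
def plus (G : Subgroup (T ≃g T)) (k : ℕ) : Subgroup (T ≃g T) :=
  Subgroup.closure {g | ∃ v w : V, T.Adj v w ∧ g ∈ edgeFixator G k v w}

end TreeAut

/-! The Baumslag–Solitar group `BS(m,n)` and its action on its Bass–Serre tree. -/

namespace BaumslagSolitar

/-- The two generators of a Baumslag–Solitar group. -/
inductive Gen : Type
  | a : Gen
  | t : Gen

/-- The relator of `BS(m,n) = ⟨a, t ∣ t a^m t⁻¹ = a^n⟩`. -/
def relator (m n : ℕ) : FreeGroup Gen :=
  FreeGroup.of Gen.t * FreeGroup.of Gen.a ^ m * (FreeGroup.of Gen.t)⁻¹ *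
    (FreeGroup.of Gen.a ^ n)⁻¹

/-- The Baumslag–Solitar group `BS(m,n) = ⟨a, t ∣ t a^m t⁻¹ = a^n⟩`. -/
abbrev BS (m n : ℕ) : Type := PresentedGroup ({relator m n} : Set (FreeGroup Gen))

/-- The generator `a` of `BS(m,n)`. -/
def a (m n : ℕ) : BS m n := PresentedGroup.of Gen.a

/-- The stable letter `t` of `BS(m,n)`. -/
def t (m n : ℕ) : BS m n := PresentedGroup.of Gen.t

/-- The vertices of the Bass–Serre tree: the left cosets `g⟨a⟩` in `BS(m,n)`. -/
abbrev Vertex (m n : ℕ) : Type := BS m n ⧸ Subgroup.zpowers (a m n)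

/-- The Bass–Serre tree of `BS(m,n)`: the edges join `g⟨a⟩` to `gt⟨a⟩`, for `g` in `BS(m,n)`.
(Since `g` is any representative of its coset, the neighbours of `u⟨a⟩` are the cosets
`u a^i t⟨a⟩` and `u a^i t⁻¹⟨a⟩`.) -/
def tree (m n : ℕ) : SimpleGraph (Vertex m n) :=
  SimpleGraph.fromRel fun x y => ∃ g : BS m n,
    x = (g : Vertex m n) ∧ y = ((g * t m n : BS m n) : Vertex m n)

theorem tree_adj_smul {m n : ℕ} (h : BS m n) {x y : Vertex m n} (hxy : (tree m n).Adj x y) :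
    (tree m n).Adj (h • x) (h • y) := by
  rw [tree, SimpleGraph.fromRel_adj] at hxy ⊢
  obtain ⟨hne, hr⟩ := hxy
  refine ⟨fun he => hne ((MulAction.injective h : Function.Injective fun z : Vertex m n => h • z) he), ?_⟩
  rcases hr with ⟨g, rfl, rfl⟩ | ⟨g, rfl, rfl⟩
  · exact Or.inl ⟨h * g, rfl, by rw [mul_assoc]; rfl⟩
  · exact Or.inr ⟨h * g, rfl, by rw [mul_assoc]; rfl⟩

/-- The action of `BS(m,n)` on its Bass–Serre tree by left multiplication of cosets. -/
def action (m n : ℕ) : BS m n →* (tree m n ≃g tree m n) where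
  toFun h :=
    { toEquiv := MulAction.toPerm h
      map_rel_iff' := by
        intro x y
        refine ⟨fun hxy => ?_, fun hxy => tree_adj_smul h hxy⟩
        have h' := tree_adj_smul h⁻¹ hxy
        simpa using h' }
  map_one' := by
    ext x
    exact one_smul (BS m n) x
  map_mul' g h := by
    ext x
    exact mul_smul g h x

/-- `BS(m,n)` as a group of automorphisms of its Bass–Serre tree. -/
def autGroup (m n : ℕ) : Subgroup (tree m n ≃g tree m n) := (action m n).range

/-- The group `(G^(k))^{+_k}` for `G = BS(m,n)` acting on its Bass–Serre tree. -/
def closurePlus (m n k : ℕ) : Subgroup (tree m n ≃g tree m n) :=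
  TreeAut.plus (TreeAut.kClosure (autGroup m n) k) k

end BaumslagSolitar

/-! Half-trees of a tree, and the closure property `P^(k)` of `k`-closures. -/

namespace TreeAut

variable {V : Type*} {T : SimpleGraph V}

/-! Everything in `G` is read off from exponents. An element of `G` fixing the vertex `g⟨a⟩` is `g
a^l g⁻¹`. Crossing an edge leaving that vertex requires `n ∣ l` or `m ∣ l`, according to the
direction, and at the next vertex replaces that factor of `l` by the other one. Since `m` and `n`
are coprime, fixing the first `R` steps of a ray with constant direction forces the `R`-th power of
the corresponding factor to divide `l`, while `(mn)^R ∣ l` makes the element fix the whole ball of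
radius `R`. A half-tree contains rays in every direction that matters, so an element of `G` that
fixes the part of `B(w,R)` in a half-tree rooted at `w` fixes all of `B(w,R)`
(`fixes_ball_of_fixes_semitree`).

Thus only the identity of `G` fixes a half-tree, whereas `a^((mn)^k)` is a nontrivial element of
some `F_{k,e}`: Property `P^(k)` fails. The `k`-closure, `k ≥ 1`, does have `P^(k)`, because
automorphisms can be glued along half-trees (`exists_glue`). It therefore contains nontrivial
elements fixing a half-tree, and such an element is outside the `l`-closure for large `l`. So no
group in the decreasing family is minimal, and the family is infinite. High powers of `a` show
non-discreteness.

Simplicity follows Tits: if `G^{+_k}` displaces every half-tree, a nontrivial normal subgroup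
contains, by ping-pong, elements all of whose positive powers displace a given half-tree. Then every
element supported on that half-tree is a commutator with one of them (`exists_eq_commutator`), and
`P^(k)` recovers all generators. For `m, n ≥ 2` the displacing elements are again conjugates of
powers of `a`. -/

theorem self_mem_ball (v : V) (k : ℕ) : v ∈ ball T v k := ⟨.nil, by simp⟩

theorem ball_mono (v : V) {k l : ℕ} (h : k ≤ l) : ball T v k ⊆ ball T v l :=
  fun _ ⟨p, hp⟩ => ⟨p, hp.trans h⟩

theorem adj_mem_ball {v w : V} (h : T.Adj v w) {k : ℕ} (hk : 1 ≤ k) : w ∈ ball T v k :=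
  ⟨h.toWalk, by simpa using hk⟩

theorem exists_mem_ball (hT : T.Connected) (v u : V) : ∃ k, u ∈ ball T v k := by
  obtain ⟨p⟩ := hT.preconnected v u
  exact ⟨p.length, p, le_rfl⟩

theorem inv_apply_eq_self {x : T ≃g T} {u : V} (h : x u = u) : x⁻¹ u = u := by
  conv_lhs => rw [← h]
  exact RelIso.inv_apply_self x u

theorem exists_finset_subset_ball (hT : T.Connected) (v : V) (F : Finset V) :
    ∃ R, ∀ u ∈ F, u ∈ ball T v R := by
  choose f hf using exists_mem_ball hT v
  exact ⟨F.sup f, fun u hu => ball_mono v (Finset.le_sup hu) (hf u)⟩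

/-! ### The permutation topology -/

theorem exists_finset_of_isOpen {U : Set (T ≃g T)} (hU : IsOpen U) {x : T ≃g T} (hx : x ∈ U) :
    ∃ F : Finset V, ∀ y : T ≃g T, (∀ v ∈ F, y v = x v) → y ∈ U := by
  classical
  induction hU with
  | basic U hU =>
    obtain ⟨z, F, rfl⟩ := hU
    exact ⟨F, fun y hy v hv => (hy v hv).trans (hx v hv)⟩
  | univ => exact ⟨∅, fun _ _ => trivial⟩
  | inter U U' _ _ ih ih' =>
    obtain ⟨F, hF⟩ := ih hx.1
    obtain ⟨F', hF'⟩ := ih' hx.2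
    exact ⟨F ∪ F', fun y hy => ⟨hF y fun v hv => hy v (Finset.mem_union_left _ hv),
      hF' y fun v hv => hy v (Finset.mem_union_right _ hv)⟩⟩
  | sUnion S _ ih =>
    obtain ⟨U, hU, hxU⟩ := hx
    obtain ⟨F, hF⟩ := ih U hU hxU
    exact ⟨F, fun y hy => ⟨U, hU, hF y hy⟩⟩

/-! ### Half-trees -/

theorem end_mem_semitree (v w : V) : w ∈ semitree T v w := SimpleGraph.Reachable.refl _

theorem mem_semitree_of_adj {v w x y : V} (hx : x ∈ semitree T v w) (h : T.Adj x y)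
    (hne : s(x, y) ≠ s(v, w)) : y ∈ semitree T v w := by
  refine SimpleGraph.Reachable.trans hx (SimpleGraph.Adj.reachable ?_)
  rw [SimpleGraph.deleteEdges_adj]
  exact ⟨h, by simpa using hne⟩

theorem semitree_induction {v w : V} {P : V → Prop} (h0 : P w)
    (hs : ∀ x y, x ∈ semitree T v w → y ∈ semitree T v w → T.Adj x y → s(x, y) ≠ s(v, w) →
      P x → P y)
    {u : V} (hu : u ∈ semitree T v w) : P u := by
  rw [semitree, Set.mem_ofPred_eq, SimpleGraph.reachable_iff_reflTransGen] at hu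
  have : u ∈ semitree T v w ∧ P u := by
    induction hu with
    | refl => exact ⟨end_mem_semitree v w, h0⟩
    | tail _ h ih =>
      rw [SimpleGraph.deleteEdges_adj] at h
      have hne := h.2
      rw [Set.mem_singleton_iff] at hne
      have hy := mem_semitree_of_adj ih.1 h.1 hne
      exact ⟨hy, hs _ _ ih.1 hy h.1 hne ih.2⟩
  exact this.2

theorem apply_mem_semitree (x : T ≃g T) {v w u : V} (hu : u ∈ semitree T v w) :
    x u ∈ semitree T (x v) (x w) := by
  refine semitree_induction (P := fun u => x u ∈ semitree T (x v) (x w))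
    (end_mem_semitree _ _) (fun y z _ _ h hne hy => ?_) hu
  refine mem_semitree_of_adj hy (x.map_rel_iff.2 h) fun he => hne ?_
  rw [← Sym2.map_mk, ← Sym2.map_mk] at he
  exact Sym2.map.injective x.injective he

theorem apply_mem_semitree_iff (x : T ≃g T) {v w u : V} :
    x u ∈ semitree T (x v) (x w) ↔ u ∈ semitree T v w := by
  refine ⟨fun h => ?_, apply_mem_semitree x⟩
  have := apply_mem_semitree x⁻¹ h
  rwa [RelIso.inv_apply_self, RelIso.inv_apply_self, RelIso.inv_apply_self] at this

section Tree

variable (hT : T.IsTree)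
include hT

theorem start_notMem_semitree {v w : V} (h : T.Adj v w) : v ∉ semitree T v w := fun hv =>
  SimpleGraph.isAcyclic_iff_forall_adj_isBridge.1 hT.isAcyclic h (SimpleGraph.Reachable.symm hv)

/-- The removed edge is the only exit from a half-tree; the later arguments about half-trees rest on
this. -/
theorem eq_of_adj_of_mem_of_notMem {v w x y : V} (h : T.Adj v w) (hxy : T.Adj x y)
    (hx : x ∈ semitree T v w) (hy : y ∉ semitree T v w) : x = w ∧ y = v := by
  by_cases he : s(x, y) = s(v, w)
  · rw [Sym2.eq_iff] at he
    rcases he with ⟨rfl, rfl⟩ | he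
    · exact absurd hx (start_notMem_semitree hT h)
    · exact he
  · exact absurd (mem_semitree_of_adj hx hxy he) hy

theorem mem_semitree_swap {v w : V} (h : T.Adj v w) (u : V) :
    u ∈ semitree T w v ↔ u ∉ semitree T v w := by
  constructor
  · intro hu
    refine semitree_induction (P := fun u => u ∉ semitree T v w)
      (start_notMem_semitree hT h) (fun y z _ _ hyz hne hy hz => ?_) hu
    obtain ⟨rfl, rfl⟩ := eq_of_adj_of_mem_of_notMem hT h hyz.symm hz hy
    exact hne Sym2.eq_swap
  · obtain ⟨p⟩ := hT.connected.preconnected u w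
    intro hu
    by_contra hu'
    have key : ∀ {a b : V} (p : T.Walk a b),
        a ∉ semitree T v w ∧ a ∉ semitree T w v → b ∉ semitree T v w := by
      intro a b p
      induction p with
      | nil => exact fun h => h.1
      | @cons a c b hac p ih =>
        rintro ⟨h1, h2⟩
        refine ih ⟨fun hc => ?_, fun hc => ?_⟩
        · obtain ⟨-, rfl⟩ := eq_of_adj_of_mem_of_notMem hT h hac.symm hc h1
          exact h2 (end_mem_semitree _ _)
        · obtain ⟨-, rfl⟩ := eq_of_adj_of_mem_of_notMem hT h.symm hac.symm hc h2
          exact h1 (end_mem_semitree _ _)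
    exact key p ⟨hu, hu'⟩ (end_mem_semitree _ _)

/-- Crossing the edge `(r, s)` means visiting `r`, which lies outside `T_(v,w)`; so a walk inside
`T_(v,w)` stays on one side of that edge. -/
theorem semitree_nested {v w r s : V} (hrs : T.Adj r s)
    (hr : r ∉ semitree T v w) :
    (∀ u ∈ semitree T v w, u ∈ semitree T r s) ∨ (∀ u ∈ semitree T v w, u ∉ semitree T r s) := by
  by_cases hw : w ∈ semitree T r s
  · left
    intro u hu
    refine semitree_induction (P := fun u => u ∈ semitree T r s) hw
      (fun y z hy hz hyz _ hyD => ?_) hu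
    by_contra hzD
    exact hr ((eq_of_adj_of_mem_of_notMem hT hrs hyz hyD hzD).2 ▸ hz)
  · right
    intro u hu
    refine semitree_induction (P := fun u => u ∉ semitree T r s) hw
      (fun y z hy hz hyz _ hyD hzD => ?_) hu
    exact hr ((eq_of_adj_of_mem_of_notMem hT hrs hyz.symm hzD hyD).2 ▸ hy)

theorem notMem_semitree_of_ne {w w₁ w₂ : V} (h₁ : T.Adj w w₁) (h₂ : T.Adj w w₂) (hne : w₁ ≠ w₂)
    {u : V} (hu : u ∈ semitree T w w₁) : u ∉ semitree T w w₂ := by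
  rcases semitree_nested hT h₂ (start_notMem_semitree hT h₁) with h | h
  · exact absurd (eq_of_adj_of_mem_of_notMem hT h₂ h₁.symm (h _ (end_mem_semitree _ _))
      (start_notMem_semitree hT h₂)).1 hne
  · exact h u hu

/-- A walk leaving the half-tree traverses `w` and then `v`, and what remains of it from either
vertex is no longer than the whole. -/
theorem mem_ball_of_mem_of_notMem {v w u z : V} (h : T.Adj v w) {k : ℕ} (hz : z ∈ ball T u k)
    (hu : u ∈ semitree T v w) (hz' : z ∉ semitree T v w) : z ∈ ball T v k ∩ ball T w k := by
  obtain ⟨p, hp⟩ := hz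
  induction p generalizing k with
  | nil => exact absurd hu hz'
  | @cons a b c hab p ih =>
    rw [SimpleGraph.Walk.length_cons] at hp
    by_cases hb : b ∈ semitree T v w
    · obtain ⟨h1, h2⟩ := ih (k := k - 1) hb hz' (by omega)
      exact ⟨ball_mono _ (by omega) h1, ball_mono _ (by omega) h2⟩
    · obtain ⟨rfl, rfl⟩ := eq_of_adj_of_mem_of_notMem hT h hab hu hb
      exact ⟨⟨p, by omega⟩, ⟨.cons hab p, by simpa using hp⟩⟩

end Tree

/-! ### Gluing automorphisms -/

/-- The automorphism `x` preserves `S`, and fixes every vertex lying at distance at most `k` from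
a vertex on the other side of `S`. -/
structure Splits (k : ℕ) (x : T ≃g T) (S : Set V) : Prop where
  apply_mem : ∀ u, x u ∈ S ↔ u ∈ S
  fixes : ∀ u, ∀ z ∈ ball T u k, ¬ (u ∈ S ↔ z ∈ S) → x z = z

theorem Splits.inv {k : ℕ} {x : T ≃g T} {S : Set V} (h : Splits k x S) : Splits k x⁻¹ S where
  apply_mem u := by rw [← h.apply_mem, RelIso.apply_inv_self]
  fixes u z hz hne := inv_apply_eq_self (h.fixes u z hz hne)

theorem Splits.conj {k : ℕ} {x : T ≃g T} {S : Set V} (h : Splits k x S) (g : T ≃g T) :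
    Splits k (g * x * g⁻¹) {u | g⁻¹ u ∈ S} where
  apply_mem u := by
    simp only [Set.mem_ofPred_eq, RelIso.mul_apply, RelIso.inv_apply_self, h.apply_mem]
  fixes u z hz hne := by
    rw [RelIso.mul_apply, RelIso.mul_apply,
      h.fixes (g⁻¹ u) (g⁻¹ z) (map_mem_ball g⁻¹ hz) hne, RelIso.apply_inv_self]

/-- Since `k ≥ 1`, both ends of the edge lie in `B(v,k) ∩ B(w,k)`, so the half-tree is preserved; a
vertex within distance `k` of the other side lies in this intersection and is fixed. -/
theorem splits_of_mem_edgeFixator (hT : T.IsTree) {G : Subgroup (T ≃g T)} {k : ℕ} (hk : 1 ≤ k)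
    {v w : V} (h : T.Adj v w) {x : T ≃g T} (hx : x ∈ edgeFixator G k v w) :
    Splits k x (semitree T v w) where
  apply_mem u := by
    have hv : x v = v := hx.2 v ⟨self_mem_ball v k, adj_mem_ball h.symm hk⟩
    have hw : x w = w := hx.2 w ⟨adj_mem_ball h hk, self_mem_ball w k⟩
    conv_lhs => rw [← hv, ← hw]
    exact apply_mem_semitree_iff x
  fixes u z hz hne := by
    refine hx.2 z ?_
    by_cases hu : u ∈ semitree T v w
    · exact mem_ball_of_mem_of_notMem hT h hz hu (by tauto)
    · rw [Set.inter_comm]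
      refine mem_ball_of_mem_of_notMem hT h.symm hz ((mem_semitree_swap hT h u).2 hu) ?_
      rw [mem_semitree_swap hT h]
      tauto

open Classical in
/-- The map that is `x i` on `S i` and the identity elsewhere. -/
noncomputable def glueFun {ι : Type*} (S : ι → Set V) (x : ι → (T ≃g T)) (u : V) : V :=
  if h : ∃ i, u ∈ S i then x h.choose u else u

section Glue

variable {ι : Type*} {S : ι → Set V} {x : ι → (T ≃g T)}

theorem glueFun_of_mem (hd : ∀ i j u, u ∈ S i → u ∈ S j → i = j) {i : ι} {u : V} (hu : u ∈ S i) :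
    glueFun S x u = x i u := by
  have h : ∃ i, u ∈ S i := ⟨i, hu⟩
  rw [glueFun, dif_pos h, hd _ _ _ h.choose_spec hu]

theorem glueFun_of_notMem {u : V} (hu : ∀ i, u ∉ S i) : glueFun S x u = u := by
  rw [glueFun, dif_neg (by simpa using hu)]

theorem glueFun_glueFun (hd : ∀ i j u, u ∈ S i → u ∈ S j → i = j) {k : ℕ}
    {y : ι → (T ≃g T)} (hx : ∀ i, Splits k (x i) (S i)) (hxy : ∀ i u, y i (x i u) = u) (u : V) :
    glueFun S y (glueFun S x u) = u := by
  by_cases h : ∃ i, u ∈ S i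
  · obtain ⟨i, hi⟩ := h
    rw [glueFun_of_mem hd hi, glueFun_of_mem hd (((hx i).apply_mem u).2 hi), hxy]
  · push Not at h
    rw [glueFun_of_notMem h, glueFun_of_notMem h]

/-- Around a vertex of `S i`, the glued map agrees with `x i`: on the part of the ball outside `S
i`, `x i` is trivial, and so is any other `x j` used there, since both sets are crossed within
distance `k`. Around a vertex in no `S i`, it agrees with the identity in the same way. -/
theorem glueFun_local (hd : ∀ i j u, u ∈ S i → u ∈ S j → i = j) {k : ℕ} {G : Subgroup (T ≃g T)}
    (hx : ∀ i, Splits k (x i) (S i)) (hG : ∀ i, x i ∈ G) (u : V) :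
    ∃ g ∈ G, ∀ z ∈ ball T u k, g z = glueFun S x z := by
  by_cases h : ∃ i, u ∈ S i
  · obtain ⟨i, hi⟩ := h
    refine ⟨x i, hG i, fun z hz => ?_⟩
    by_cases hzi : z ∈ S i
    · rw [glueFun_of_mem hd hzi]
    · rw [(hx i).fixes u z hz (by tauto)]
      by_cases hzj : ∃ j, z ∈ S j
      · obtain ⟨j, hj⟩ := hzj
        rw [glueFun_of_mem hd hj, (hx j).fixes u z hz]
        intro hu
        exact hzi (hd i j u hi (hu.2 hj) ▸ hj)
      · rw [glueFun_of_notMem (by simpa using hzj)]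
  · push Not at h
    refine ⟨1, G.one_mem, fun z hz => ?_⟩
    rw [RelIso.one_apply]
    by_cases hzj : ∃ j, z ∈ S j
    · obtain ⟨j, hj⟩ := hzj
      rw [glueFun_of_mem hd hj, (hx j).fixes u z hz]
      intro hu
      exact h j (hu.2 hj)
    · rw [glueFun_of_notMem (by simpa using hzj)]

theorem exists_glue (hd : ∀ i j u, u ∈ S i → u ∈ S j → i = j) {k : ℕ} (hk : 1 ≤ k)
    {G : Subgroup (T ≃g T)} (hx : ∀ i, Splits k (x i) (S i)) (hG : ∀ i, x i ∈ G) :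
    ∃ y ∈ kClosure G k, (∀ i, ∀ u ∈ S i, y u = x i u) ∧ ∀ u, (∀ i, u ∉ S i) → y u = u := by
  have hadj : ∀ x : ι → (T ≃g T), (∀ i, Splits k (x i) (S i)) → ∀ {u z}, T.Adj u z →
      T.Adj (glueFun S x u) (glueFun S x z) := by
    intro x hx u z huz
    -- Adjacency is visible in a ball of radius `1 ≤ k`, where the glued map agrees with some
    -- automorphism; which one is irrelevant, hence `⊤`.
    obtain ⟨g, -, hg⟩ := glueFun_local (G := ⊤) hd hx (fun _ => trivial) u
    rw [← hg u (self_mem_ball u k), ← hg z (adj_mem_ball huz hk)]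
    exact g.map_rel_iff.2 huz
  have hl := glueFun_glueFun hd (y := fun i => (x i)⁻¹) hx (fun i u => RelIso.inv_apply_self _ _)
  have hr := glueFun_glueFun hd (x := fun i => (x i)⁻¹) (y := x) (fun i => (hx i).inv)
    (fun i u => RelIso.apply_inv_self _ _)
  let y : T ≃g T :=
    { toFun := glueFun S x
      invFun := glueFun S fun i => (x i)⁻¹
      left_inv := hl
      right_inv := hr
      map_rel_iff' := by
        intro u z
        refine ⟨fun h => ?_, hadj x hx⟩
        have := hadj (fun i => (x i)⁻¹) (fun i => (hx i).inv) h
        simp only [Equiv.coe_fn_mk] at this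
        rwa [hl, hl] at this }
  exact ⟨y, glueFun_local hd hx hG, fun i u hu => glueFun_of_mem hd hu,
    fun u hu => glueFun_of_notMem hu⟩

end Glue

/-! ### `k`-closures -/

theorem edgeFixator_mono {G H : Subgroup (T ≃g T)} (h : G ≤ H)
    (k : ℕ) (v w : V) : edgeFixator G k v w ≤ edgeFixator H k v w :=
  fun _ hx => ⟨h hx.1, hx.2⟩

theorem le_kClosure (G : Subgroup (T ≃g T)) (k : ℕ) : G ≤ kClosure G k :=
  fun g hg _ => ⟨g, hg, fun _ _ => rfl⟩

theorem kClosure_kClosure_le (G : Subgroup (T ≃g T)) (k : ℕ) :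
    kClosure (kClosure G k) k ≤ kClosure G k := by
  intro x hx v
  obtain ⟨y, hy, hyx⟩ := hx v
  obtain ⟨g, hg, hgy⟩ := hy v
  exact ⟨g, hg, fun u hu => (hgy u hu).trans (hyx u hu)⟩

theorem kClosure_anti (G : Subgroup (T ≃g T)) {k l : ℕ} (h : k ≤ l) :
    kClosure G l ≤ kClosure G k := by
  intro x hx v
  obtain ⟨g, hg, hgx⟩ := hx v
  exact ⟨g, hg, fun u hu => hgx u (ball_mono v h hu)⟩

theorem plus_le (G : Subgroup (T ≃g T)) (k : ℕ) : plus G k ≤ G := by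
  rw [plus, Subgroup.closure_le]
  rintro g ⟨v, w, -, hg⟩
  exact hg.1

theorem mem_plus_of_mem_edgeFixator {G : Subgroup (T ≃g T)} {k : ℕ} {v w : V} (h : T.Adj v w)
    {x : T ≃g T} (hx : x ∈ edgeFixator G k v w) : x ∈ plus G k :=
  Subgroup.subset_closure ⟨v, w, h, hx⟩

theorem plus_kClosure_anti (G : Subgroup (T ≃g T)) {k l : ℕ} (h : k ≤ l) :
    plus (kClosure G l) l ≤ plus (kClosure G k) k := by
  refine (Subgroup.closure_le _).2 ?_
  rintro g ⟨v, w, hvw, hg, hfix⟩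
  exact mem_plus_of_mem_edgeFixator hvw
    ⟨kClosure_anti G h hg, fun u hu => hfix u ⟨ball_mono v h hu.1, ball_mono w h hu.2⟩⟩

/-- Restrict `g` to one half-tree and extend by the identity. The resulting `y` lies in the
`k`-closure, and `g * y⁻¹` is trivial on that half-tree. -/
theorem propertyP_of_kClosure_le (hT : T.IsTree) {G : Subgroup (T ≃g T)} {k : ℕ} (hk : 1 ≤ k)
    (hG : kClosure G k ≤ G) : PropertyP G k := by
  intro v w h
  refine Set.Subset.antisymm (fun g hg => ?_) ?_
  · have hs := splits_of_mem_edgeFixator hT hk h hg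
    obtain ⟨y, hy, hyS, hyn⟩ := exists_glue (ι := Unit) (S := fun _ => semitree T v w)
      (x := fun _ => g) (fun _ _ _ _ _ => rfl) hk (fun _ => hs) (fun _ => hg.1)
    have hyg : ∀ u ∈ semitree T v w, y u = g u := hyS ()
    have hyn : ∀ u ∉ semitree T v w, y u = u := fun u hu => hyn u fun _ => hu
    have hyF : y ∈ edgeFixator G k v w := by
      refine ⟨hG hy, fun u hu => ?_⟩
      by_cases huS : u ∈ semitree T v w
      · rw [hyg u huS, hg.2 u hu]
      · exact hyn u huS
    refine Set.mem_mul.2 ⟨g * y⁻¹, ⟨mul_mem hg (inv_mem hyF), fun u hu => ?_⟩, y,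
      ⟨hyF, fun u hu => hyn u ((mem_semitree_swap hT h u).1 hu)⟩, by simp⟩
    have hu' : y⁻¹ u ∈ semitree T v w := by
      by_contra hn
      have := hyn _ hn
      rw [RelIso.apply_inv_self] at this
      exact hn (this ▸ hu)
    rw [RelIso.mul_apply, ← hyg _ hu', RelIso.apply_inv_self]
  · rintro _ ⟨x, hx, y, hy, rfl⟩
    exact mul_mem (S := Subgroup (T ≃g T)) hx.1 hy.1

end TreeAut

/-! Simplicity of `G^{+_k}` for `k`-closed groups. -/

namespace TreeAut

variable {V : Type*} {T : SimpleGraph V}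

/-- Every vertex has at least three neighbours. -/
def ThreeNeighbors (T : SimpleGraph V) : Prop :=
  ∀ u, ∃ a b c, T.Adj u a ∧ T.Adj u b ∧ T.Adj u c ∧ a ≠ b ∧ a ≠ c ∧ b ≠ c

section

variable (hT : T.IsTree)
include hT

/-- For a vertex `u` moved by `x`, the vertices `x u` and `x⁻¹ u` lie in at most two branches at
`u`, so a third branch contains neither. Its image starts outside it and could enter it only through
`u`, that is, if the branch contained `x⁻¹ u`. -/
theorem exists_displaced_semitree (h3 : ThreeNeighbors T) {x : T ≃g T} (hx : x ≠ 1) :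
    ∃ v w, T.Adj v w ∧ ∀ u ∈ semitree T v w, x u ∉ semitree T v w := by
  obtain ⟨u, hu⟩ : ∃ u, x u ≠ u := by
    by_contra! h
    exact hx (RelIso.ext h)
  obtain ⟨w, huw, h1, h2⟩ :
      ∃ w, T.Adj u w ∧ x u ∉ semitree T u w ∧ x⁻¹ u ∉ semitree T u w := by
    obtain ⟨a, b, c, ha, hb, hc, hab, hac, hbc⟩ := h3 u
    have d : ∀ z, (z ∈ semitree T u a → z ∉ semitree T u b ∧ z ∉ semitree T u c) ∧
        (z ∈ semitree T u b → z ∉ semitree T u c) := fun z =>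
      ⟨fun hz => ⟨notMem_semitree_of_ne hT ha hb hab hz, notMem_semitree_of_ne hT ha hc hac hz⟩,
        fun hz => notMem_semitree_of_ne hT hb hc hbc hz⟩
    have d1 := d (x u)
    have d2 := d (x⁻¹ u)
    by_contra! h
    have ea := h a ha
    have eb := h b hb
    have ec := h c hc
    tauto
  refine ⟨u, w, huw, fun z hz => ?_⟩
  refine semitree_induction (P := fun z => x z ∉ semitree T u w) (fun hw => ?_)
    (fun y z hy hz hyz _ hxy hxz => ?_) hz
  · exact hu (eq_of_adj_of_mem_of_notMem hT huw (x.map_rel_iff.2 huw.symm) hw h1).2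
  · have := (eq_of_adj_of_mem_of_notMem hT huw (x.map_rel_iff.2 hyz.symm) hxz hxy).2
    have hxu : x⁻¹ u = y := by rw [← this, RelIso.inv_apply_self]
    exact h2 (hxu ▸ hy)

variable {P : Subgroup (T ≃g T)}
  (hP : ∀ v w, T.Adj v w → ∃ g ∈ P, ∀ u ∈ semitree T v w, g u ∉ semitree T v w)
include hP

/-- Displacing the opposite half-tree `T_(s,r)` pushes the complement of `T_(r,s)` into `T_(r,s)`.
This settles the disjoint case when `r` is outside `T_(v,w)`; when `r` is inside, `T_(v,w)` is first
moved into `T_(w,v)`. -/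
theorem exists_map_semitree_into {v w r s : V} (hvw : T.Adj v w) (hrs : T.Adj r s) :
    ∃ g ∈ P, ∀ u ∈ semitree T v w, g u ∈ semitree T r s := by
  have into : ∀ v w, T.Adj v w → ∃ g ∈ P, ∀ u ∉ semitree T v w, g u ∈ semitree T v w := by
    intro v w h
    obtain ⟨g, hg, hgm⟩ := hP w v h.symm
    refine ⟨g, hg, fun u hu => ?_⟩
    have := hgm u ((mem_semitree_swap hT h u).2 hu)
    rw [mem_semitree_swap hT h] at this
    tauto
  by_cases hr : r ∈ semitree T v w
  · have hr' : r ∉ semitree T w v := by rw [mem_semitree_swap hT hvw]; tauto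
    obtain ⟨α, hα, hαm⟩ := hP v w hvw
    have hαm' : ∀ u ∈ semitree T v w, α u ∈ semitree T w v := fun u hu =>
      (mem_semitree_swap hT hvw _).2 (hαm u hu)
    rcases semitree_nested hT hrs hr' with h | h
    · exact ⟨α, hα, fun u hu => h _ (hαm' u hu)⟩
    · obtain ⟨β, hβ, hβm⟩ := into r s hrs
      exact ⟨β * α, mul_mem hβ hα, fun u hu => hβm _ (h _ (hαm' u hu))⟩
  · rcases semitree_nested hT hrs hr with h | h
    · exact ⟨1, one_mem _, h⟩
    · obtain ⟨β, hβ, hβm⟩ := into r s hrs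
      exact ⟨β, hβ, fun u hu => hβm _ (h _ hu)⟩

variable (h3 : ThreeNeighbors T) {N : Subgroup (T ≃g T)}
  (hN : ∀ g ∈ P, ∀ x ∈ N, g * x * g⁻¹ ∈ N) (hN1 : N ≠ ⊥)
include h3 hN hN1

theorem exists_mem_displacing {v w : V} (hvw : T.Adj v w) :
    ∃ a ∈ N, ∀ u ∈ semitree T v w, a u ∉ semitree T v w := by
  obtain ⟨x, hxN, hx1⟩ := N.bot_or_exists_ne_one.resolve_left hN1
  obtain ⟨r, s, hrs, hx⟩ := exists_displaced_semitree hT h3 hx1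
  obtain ⟨g, hg, hgm⟩ := exists_map_semitree_into hT hP hvw hrs
  refine ⟨g⁻¹ * x * g, by simpa using hN g⁻¹ (inv_mem hg) x hxN, fun u hu hu' => ?_⟩
  refine hx (g u) (hgm u hu) ?_
  have := hgm _ hu'
  rwa [RelIso.mul_apply, RelIso.mul_apply, RelIso.apply_inv_self] at this

/-- Ping-pong with two further neighbours `w₁`, `w₂` of `v`: `a` sends the complement of the branch
at `w₁` into that branch, and `b` does the same for `w₂`. So `b * a` sends the complement of the
first branch into the second, where all positive powers keep `T_(v,w)`. -/
theorem exists_mem_forall_pow_disjoint {v w : V} (hvw : T.Adj v w) :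
    ∃ h ∈ N, ∀ i : ℕ, ∀ u ∈ semitree T v w, (h ^ (i + 1)) u ∉ semitree T v w := by
  obtain ⟨w₁, w₂, h₁, h₂, hne, hv₁, hv₂⟩ :
      ∃ w₁ w₂, T.Adj v w₁ ∧ T.Adj v w₂ ∧ w₁ ≠ w₂ ∧ w ≠ w₁ ∧ w ≠ w₂ := by
    obtain ⟨a, b, c, ha, hb, hc, hab, hac, hbc⟩ := h3 v
    by_cases hwa : w = a
    · exact ⟨b, c, hb, hc, hbc, hwa ▸ hab, hwa ▸ hac⟩
    · by_cases hwb : w = b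
      · exact ⟨a, c, ha, hc, hac, hwa, hwb ▸ hbc⟩
      · exact ⟨a, b, ha, hb, hab, hwa, hwb⟩
  obtain ⟨a, ha, ham⟩ := exists_mem_displacing hT hP h3 hN hN1 h₁.symm
  obtain ⟨b, hb, hbm⟩ := exists_mem_displacing hT hP h3 hN hN1 h₂.symm
  simp only [mem_semitree_swap hT h₁, mem_semitree_swap hT h₂, not_not] at ham hbm
  have hstep : ∀ u ∉ semitree T v w₁, (b * a) u ∈ semitree T v w₂ := fun u hu =>
    hbm _ (notMem_semitree_of_ne hT h₁ h₂ hne (ham u hu))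
  refine ⟨b * a, mul_mem hb ha, fun i u hu => ?_⟩
  have hu₁ : u ∉ semitree T v w₁ := notMem_semitree_of_ne hT hvw h₁ hv₁ hu
  have key : ∀ i : ℕ, ((b * a) ^ (i + 1)) u ∈ semitree T v w₂ := by
    intro i
    induction i with
    | zero => simpa using hstep u hu₁
    | succ i ih =>
      rw [pow_succ', RelIso.mul_apply]
      exact hstep _ (notMem_semitree_of_ne hT h₂ h₁ hne.symm ih)
  exact notMem_semitree_of_ne hT h₂ hvw hv₂.symm (key i)

end

/-- If `h` translates a half-tree off itself, an element of `F_{k,e}` supported on that half-tree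
is a commutator of `h` with an element of `G^{+_k}`. -/
theorem exists_eq_commutator (hT : T.IsTree) {G : Subgroup (T ≃g T)} {k : ℕ} (hk : 1 ≤ k)
    (hG : kClosure G k ≤ G) {v w : V} (hvw : T.Adj v w) {h : T ≃g T} (hhG : h ∈ G)
    (hh : ∀ i : ℕ, ∀ u ∈ semitree T v w, (h ^ (i + 1)) u ∉ semitree T v w)
    {x : T ≃g T} (hx : x ∈ fixator (edgeFixator G k v w) (semitree T w v)) :
    ∃ y ∈ plus G k, x = y * h * y⁻¹ * h⁻¹ := by
  have hxS : ∀ u ∉ semitree T v w, x u = u := fun u hu =>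
    hx.2 u ((mem_semitree_swap hT hvw u).2 hu)
  -- `S i` is the translate of `T_(v,w)` by `h ^ i`; the hypothesis on powers makes these translates
  -- pairwise disjoint.
  let S : ℕ → Set V := fun i => {u | (h ^ i)⁻¹ u ∈ semitree T v w}
  have hlt : ∀ i j u, i < j → u ∈ S i → u ∈ S j → False := by
    intro i j u hij hi hj
    obtain ⟨d, rfl⟩ := Nat.exists_eq_add_of_lt hij
    refine hh d _ hj ?_
    have : (h ^ (d + 1)) ((h ^ (i + d + 1))⁻¹ u) = (h ^ i)⁻¹ u := by
      rw [← RelIso.mul_apply]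
      congr 1
      rw [add_assoc, add_comm i, pow_add]
      group
    rw [this]
    exact hi
  have hd : ∀ i j u, u ∈ S i → u ∈ S j → i = j := by
    intro i j u hi hj
    rcases lt_trichotomy i j with hij | hij | hij
    · exact (hlt i j u hij hi hj).elim
    · exact hij
    · exact (hlt j i u hij hj hi).elim
  have hsp : ∀ i, Splits k (h ^ i * x * (h ^ i)⁻¹) (S i) := fun i =>
    (splits_of_mem_edgeFixator hT hk hvw hx.1).conj (h ^ i)
  -- `y` is the infinite product of the `h ^ i * x * (h ^ i)⁻¹` over `i ≥ 0`. Conjugating it by `h`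
  -- drops exactly the factor `i = 0`, which is `x`.
  obtain ⟨y, hy, hyS, hyn⟩ := exists_glue hd hk hsp fun i =>
    G.mul_mem (G.mul_mem (G.pow_mem hhG i) hx.1.1) (G.inv_mem (G.pow_mem hhG i))
  have hy1 : ∀ i, ∀ u, u ∈ S i → y u = (h ^ i) (x ((h ^ i)⁻¹ u)) := hyS
  -- The edge witnessing `y ∈ plus G k` is the `h⁻¹`-translate of `(v, w)`: `h⁻¹ w` lies in no `S
  -- i`, so every factor is trivial on the part of its support within distance `k` of it.
  refine ⟨y, mem_plus_of_mem_edgeFixator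
    ((h⁻¹ : T ≃g T).map_rel_iff.2 hvw) ⟨hG hy, fun u hu => ?_⟩, ?_⟩
  · by_cases hS : ∃ i, u ∈ S i
    · obtain ⟨i, hi⟩ := hS
      rw [hyS i u hi]
      refine (hsp i).fixes _ u hu.2 fun hiff => ?_
      refine hh i _ (hiff.2 hi) ?_
      have : (h ^ (i + 1)) ((h ^ i)⁻¹ (h⁻¹ w)) = w := by
        rw [← RelIso.mul_apply, ← RelIso.mul_apply, pow_succ']
        simp
      rw [this]
      exact end_mem_semitree v w
    · exact hyn u (by simpa using hS)
  · rw [eq_mul_inv_iff_mul_eq, eq_mul_inv_iff_mul_eq]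
    have hsucc : ∀ i u, (h ^ (i + 1))⁻¹ (h u) = (h ^ i)⁻¹ u := by
      intro i u
      rw [← RelIso.mul_apply, pow_succ']
      simp
    have hS0 : ∀ u, u ∈ S 0 ↔ u ∈ semitree T v w := fun u => by simp [S]
    ext u
    change x (h (y u)) = y (h u)
    symm
    by_cases hS : ∃ i, u ∈ S i
    · obtain ⟨i, hi⟩ := hS
      have hi' : h u ∈ S (i + 1) := by simpa only [S, Set.mem_ofPred_eq, hsucc] using hi
      have e : h (y u) = y (h u) := by
        rw [hy1 i u hi, hy1 _ _ hi', hsucc, pow_succ', RelIso.mul_apply]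
      rw [e, hxS]
      intro hmem
      refine hlt 0 (i + 1) (y (h u)) i.succ_pos ((hS0 _).2 hmem) ?_
      rw [hyS _ _ hi']
      exact ((hsp (i + 1)).apply_mem _).2 hi'
    · push Not at hS
      rw [hyn u hS]
      by_cases h0 : h u ∈ semitree T v w
      · rw [hy1 0 _ ((hS0 _).2 h0)]
        simp
      · rw [hxS _ h0]
        refine hyn _ fun i hi => ?_
        cases i with
        | zero => exact h0 ((hS0 _).1 hi)
        | succ i => exact hS i (by simpa only [S, Set.mem_ofPred_eq, hsucc] using hi)

/-- By `P^(k)` each generator is a product of two elements supported on half-trees. Each of them is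
a commutator of an element of `plus G k` with an element of the normal subgroup, hence lies in the
latter. -/
theorem isSimpleGroup_plus [Nonempty V] (hT : T.IsTree) (h3 : ThreeNeighbors T)
    {G : Subgroup (T ≃g T)} {k : ℕ} (hk : 1 ≤ k) (hG : kClosure G k ≤ G)
    (hP : ∀ v w, T.Adj v w → ∃ g ∈ plus G k, ∀ u ∈ semitree T v w, g u ∉ semitree T v w) :
    IsSimpleGroup (plus G k) := by
  have hle : ∀ N : Subgroup (T ≃g T), N ≤ plus G k → N ≠ ⊥ →
      (∀ g ∈ plus G k, ∀ x ∈ N, g * x * g⁻¹ ∈ N) → plus G k ≤ N := by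
    intro N hNP hN1 hN
    have hhalf : ∀ {v w x}, T.Adj v w →
        x ∈ fixator (edgeFixator G k v w) (semitree T w v) → x ∈ N := by
      intro v w x hvw hx
      obtain ⟨h, hhN, hh⟩ := exists_mem_forall_pow_disjoint hT hP h3 hN hN1 hvw
      obtain ⟨y, hy, rfl⟩ :=
        exists_eq_commutator hT hk hG hvw (plus_le G k (hNP hhN)) hh hx
      exact mul_mem (hN y hy h hhN) (inv_mem hhN)
    refine (Subgroup.closure_le _).2 ?_
    rintro g ⟨v, w, hvw, hg⟩
    have hg' : g ∈ (edgeFixator G k v w : Set (T ≃g T)) := hg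
    rw [propertyP_of_kClosure_le hT hk hG v w hvw] at hg'
    obtain ⟨x, hx, y, hy, rfl⟩ := hg'
    refine mul_mem (hhalf hvw.symm ?_) (hhalf hvw hy)
    rw [edgeFixator, Set.inter_comm]
    exact hx
  obtain ⟨u⟩ := ‹Nonempty V›
  obtain ⟨w, -, -, huw, -⟩ := h3 u
  obtain ⟨g, hg, hgm⟩ := hP u w huw
  have hg1 : g ≠ 1 := by
    rintro rfl
    exact hgm w (end_mem_semitree u w) (end_mem_semitree u w)
  have : Nontrivial (plus G k) := ⟨⟨⟨g, hg⟩, 1, fun h => hg1 (congrArg Subtype.val h)⟩⟩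
  refine ⟨fun N hN => ?_⟩
  by_cases hN1 : N = ⊥
  · exact Or.inl hN1
  right
  have := hle (N.map (plus G k).subtype) (Subgroup.map_subtype_le N)
    (fun h => hN1 ((Subgroup.map_eq_bot_iff_of_injective N (plus G k).subtype_injective).1 h)) (by
      rintro g hg _ ⟨x, hx, rfl⟩
      exact ⟨⟨g, hg⟩ * x * ⟨g, hg⟩⁻¹, hN.conj_mem x hx ⟨g, hg⟩, rfl⟩)
  rw [Subgroup.eq_top_iff']
  rintro ⟨x, hx⟩
  obtain ⟨y, hy, hyx⟩ := this hx
  rwa [show (⟨x, hx⟩ : plus G k) = y from Subtype.ext hyx.symm]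

end TreeAut

/-! The Bass–Serre tree of `BS(m,n)` is a tree. -/

namespace BaumslagSolitar

variable {m n : ℕ}

/-- The stable letter or its inverse. -/
def s (m n : ℕ) (ε : ℤˣ) : BS m n := t m n ^ (ε : ℤ)

/-- The index of the edge group in the vertex group, in the direction `ε`. -/
def c (m n : ℕ) (ε : ℤˣ) : ℕ := if ε = 1 then n else m

theorem c_one : c m n 1 = n := rfl

theorem c_neg_one : c m n (-1) = m := rfl

theorem c_pos (hm : 1 ≤ m) (hn : 1 ≤ n) (ε : ℤˣ) : 1 ≤ c m n ε := by
  rcases Int.units_eq_one_or ε with rfl | rfl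
  exacts [hn, hm]

theorem c_mul_c_neg (ε : ℤˣ) : c m n ε * c m n (-ε) = m * n := by
  rcases Int.units_eq_one_or ε with rfl | rfl
  exacts [mul_comm n m, rfl]

theorem coprime_c (h : m.Coprime n) (ε : ℤˣ) : (c m n ε).Coprime (c m n (-ε)) := by
  rcases Int.units_eq_one_or ε with rfl | rfl
  exacts [h.symm, h]

theorem s_neg (ε : ℤˣ) : s m n (-ε) = (s m n ε)⁻¹ := by
  rw [s, s, Units.val_neg, zpow_neg]

theorem s_one : s m n 1 = t m n := by simp [s]

theorem t_mul_a_pow : t m n * a m n ^ m * (t m n)⁻¹ = a m n ^ n := by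
  have h : PresentedGroup.mk {relator m n} (relator m n) = 1 :=
    PresentedGroup.one_of_mem (Set.mem_singleton _)
  simp only [relator] at h
  exact mul_inv_eq_one.1 h

theorem s_inv_mul_a_zpow_mul_s (ε : ℤˣ) (j : ℤ) :
    (s m n ε)⁻¹ * a m n ^ ((c m n ε : ℤ) * j) * s m n ε = a m n ^ ((c m n (-ε) : ℤ) * j) := by
  have h1 : t m n * a m n ^ ((m : ℤ) * j) * (t m n)⁻¹ = a m n ^ ((n : ℤ) * j) := by
    rw [zpow_mul, zpow_mul, ← conj_zpow, zpow_natCast, zpow_natCast, t_mul_a_pow]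
  rcases Int.units_eq_one_or ε with rfl | rfl
  · rw [s_one, c_one, c_neg_one, ← h1]
    group
  · rw [s_neg, neg_neg, s_one, c_one, c_neg_one, ← h1]
    group

/-! ### The height function -/

/-- The homomorphism to `ℤ` with `a ↦ 0`, `t ↦ 1`. -/
def height (m n : ℕ) : BS m n →* Multiplicative ℤ :=
  PresentedGroup.toGroup (f := fun x => match x with
    | Gen.a => 1
    | Gen.t => Multiplicative.ofAdd 1) (by
    rintro r rfl
    simp [relator])

theorem height_a : height m n (a m n) = 1 := PresentedGroup.toGroup.of _

theorem height_s (ε : ℤˣ) : height m n (s m n ε) = Multiplicative.ofAdd (ε : ℤ) := by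
  have : height m n (t m n) = Multiplicative.ofAdd 1 := PresentedGroup.toGroup.of _
  rw [s, map_zpow, this, ← ofAdd_zsmul, smul_eq_mul, mul_one]

/-- Height thus descends to vertices and distinguishes them without normal forms. -/
theorem height_eq_of_mk_eq {g h : BS m n} (e : (g : Vertex m n) = h) :
    height m n g = height m n h := by
  obtain ⟨i, hi⟩ := Subgroup.mem_zpowers_iff.1 (QuotientGroup.eq.1 e)
  rw [eq_inv_mul_iff_mul_eq] at hi
  rw [← hi, map_mul, map_zpow, height_a, one_zpow, mul_one]

/-! ### Adjacency -/

theorem mk_mul_a_zpow (g : BS m n) (i : ℤ) : ((g * a m n ^ i : BS m n) : Vertex m n) = g :=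
  QuotientGroup.mk_mul_of_mem g (Subgroup.zpow_mem_zpowers _ i)

theorem adj_mul_s (g : BS m n) (ε : ℤˣ) :
    (tree m n).Adj (g : Vertex m n) ((g * s m n ε : BS m n) : Vertex m n) := by
  rw [tree, SimpleGraph.fromRel_adj]
  refine ⟨fun h => ?_, ?_⟩
  · have := height_eq_of_mk_eq h
    rw [map_mul, height_s, left_eq_mul, ofAdd_eq_one] at this
    exact ε.ne_zero this
  · rcases Int.units_eq_one_or ε with rfl | rfl
    · exact Or.inl ⟨g, rfl, by rw [s_one]⟩
    · exact Or.inr ⟨g * s m n (-1), rfl, by rw [s_neg, s_one, inv_mul_cancel_right]⟩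

theorem adj_iff {x y : Vertex m n} : (tree m n).Adj x y ↔
    ∃ (g : BS m n) (ε : ℤˣ), x = g ∧ y = ((g * s m n ε : BS m n) : Vertex m n) := by
  constructor
  · rw [tree, SimpleGraph.fromRel_adj]
    rintro ⟨-, ⟨g, rfl, rfl⟩ | ⟨g, rfl, rfl⟩⟩
    · exact ⟨g, 1, rfl, by rw [s_one]⟩
    · exact ⟨g * t m n, -1, rfl, by rw [s_neg, s_one, mul_inv_cancel_right]⟩
  · rintro ⟨g, ε, rfl, rfl⟩
    exact adj_mul_s g ε

theorem adj_mk_iff {g : BS m n} {y : Vertex m n} : (tree m n).Adj g y ↔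
    ∃ (i : ℤ) (ε : ℤˣ), y = ((g * a m n ^ i * s m n ε : BS m n) : Vertex m n) := by
  constructor
  · intro h
    obtain ⟨g', ε, hg, rfl⟩ := adj_iff.1 h
    obtain ⟨i, hi⟩ := Subgroup.mem_zpowers_iff.1 (QuotientGroup.eq.1 hg)
    refine ⟨i, ε, ?_⟩
    rw [hi, mul_inv_cancel_left]
  · rintro ⟨i, ε, rfl⟩
    have := adj_mul_s (g * a m n ^ i) ε
    rwa [mk_mul_a_zpow] at this

theorem action_mk (g h : BS m n) :
    action m n g (h : Vertex m n) = ((g * h : BS m n) : Vertex m n) := rfl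

/-- As the action preserves adjacency, the elements whose coset is reachable from `⟨a⟩` form a
subgroup, and it contains both generators. -/
theorem tree_connected : (tree m n).Connected := by
  let K : Subgroup (BS m n) :=
    { carrier := {g | (tree m n).Reachable ((1 : BS m n) : Vertex m n) g}
      one_mem' := SimpleGraph.Reachable.refl _
      mul_mem' := by
        intro g h hg hh
        have := hh.map (action m n g).toHom
        have e : (tree m n).Reachable (g : Vertex m n) ((g * h : BS m n) : Vertex m n) := by
          simpa [action_mk] using this
        exact hg.trans e
      inv_mem' := by
        intro g hg
        have := hg.map (action m n g⁻¹).toHom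
        have e : (tree m n).Reachable ((g⁻¹ : BS m n) : Vertex m n) ((1 : BS m n) : Vertex m n) := by
          change (tree m n).Reachable ((g⁻¹ * 1 : BS m n) : Vertex m n)
            ((g⁻¹ * g : BS m n) : Vertex m n) at this
          rwa [mul_one, inv_mul_cancel] at this
        exact e.symm }
  have hK : K = ⊤ := by
    rw [eq_top_iff, ← PresentedGroup.closure_range_of, Subgroup.closure_le]
    rintro _ ⟨x, rfl⟩
    cases x with
    | a =>
      have : ((PresentedGroup.of Gen.a : BS m n) : Vertex m n) = ((1 : BS m n) : Vertex m n) := by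
        have := mk_mul_a_zpow (1 : BS m n) 1
        rwa [one_mul, zpow_one] at this
      change (tree m n).Reachable _ ((PresentedGroup.of Gen.a : BS m n) : Vertex m n)
      rw [this]
    | t =>
      have := adj_mul_s (1 : BS m n) 1
      rw [s_one, one_mul] at this
      exact this.reachable
  have hr : ∀ x : Vertex m n, (tree m n).Reachable ((1 : BS m n) : Vertex m n) x := by
    intro x
    induction x using QuotientGroup.induction_on with
    | H g => exact (hK ▸ Subgroup.mem_top g : g ∈ K)
  exact (SimpleGraph.connected_iff_exists_forall_reachable _).2 ⟨_, hr⟩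

/-! ### Britton's lemma -/

/-- `BS(m,n)` maps to an HNN extension of `ℤ`. -/
theorem exists_hom_HNNExtension (hm : 1 ≤ m) (hn : 1 ≤ n) :
    ∃ (A B : Subgroup (Multiplicative ℤ)) (φ : A ≃* B)
      (f : BS m n →* HNNExtension (Multiplicative ℤ) A B φ),
      f (a m n) = HNNExtension.of (Multiplicative.ofAdd 1) ∧ f (t m n) = HNNExtension.t ∧
      ∀ (ε : ℤˣ) (l : ℤ), Multiplicative.ofAdd l ∈ HNNExtension.toSubgroup A B ε →
        (c m n (-ε) : ℤ) ∣ l := by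
  -- `p k` is multiplication by `k`. The associated subgroups are `mℤ` and `nℤ`, identified by `m j
  -- ↦ n j`. Only a homomorphism to the extension is needed: nontriviality there implies it in `BS m
  -- n`.
  let p : ℕ → (Multiplicative ℤ →* Multiplicative ℤ) := fun k =>
    zpowersHom _ (Multiplicative.ofAdd (k : ℤ))
  have hp : ∀ k j, p k (Multiplicative.ofAdd j) = Multiplicative.ofAdd (j * k : ℤ) := by
    intro k j
    simp [p, ← ofAdd_zsmul]
  have hinj : ∀ k, 1 ≤ k → Function.Injective (p k) := by
    intro k hk x y hxy
    induction x with | ofAdd x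
    induction y with | ofAdd y
    rw [hp, hp] at hxy
    have hxy : x * k = y * k := Multiplicative.ofAdd.injective hxy
    rw [mul_right_cancel₀ (by exact_mod_cast (by omega : k ≠ 0)) hxy]
  let e : (p m).range ≃* (p n).range :=
    (MonoidHom.ofInjective (hinj m hm)).symm.trans (MonoidHom.ofInjective (hinj n hn))
  have he : ∀ x, e ⟨p m x, x, rfl⟩ = ⟨p n x, x, rfl⟩ := by
    intro x
    have : (⟨p m x, x, rfl⟩ : (p m).range) = MonoidHom.ofInjective (hinj m hm) x := rfl
    rw [this]
    simp only [e, MulEquiv.trans_apply, MulEquiv.symm_apply_apply]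
    rfl
  let F : Gen → HNNExtension (Multiplicative ℤ) _ _ e := fun x => match x with
    | Gen.a => HNNExtension.of (Multiplicative.ofAdd 1)
    | Gen.t => HNNExtension.t
  have hF : ∀ r ∈ ({relator m n} : Set (FreeGroup Gen)), FreeGroup.lift F r = 1 := by
    rintro r rfl
    have := HNNExtension.equiv_eq_conj (φ := e) ⟨p m (Multiplicative.ofAdd 1), _, rfl⟩
    rw [he] at this
    simp only [hp, one_mul] at this
    simp only [relator, map_mul, map_pow, map_inv, FreeGroup.lift_apply_of, F]
    rw [mul_inv_eq_one, ← map_pow HNNExtension.of, ← map_pow HNNExtension.of, ← ofAdd_nsmul, ← ofAdd_nsmul]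
    simpa using this.symm
  refine ⟨_, _, e, PresentedGroup.toGroup hF, PresentedGroup.toGroup.of hF,
    PresentedGroup.toGroup.of hF, fun ε l hl => ?_⟩
  have hdvd : ∀ k : ℕ, Multiplicative.ofAdd l ∈ (p k).range → (k : ℤ) ∣ l := by
    rintro k ⟨x, hx⟩
    induction x with | ofAdd x
    rw [hp] at hx
    exact ⟨x, by rw [mul_comm]; exact (Multiplicative.ofAdd.injective hx).symm⟩
  rcases Int.units_eq_one_or ε with rfl | rfl
  · exact hdvd m hl
  · rw [neg_neg]
    exact hdvd n hl

/-- The word `s ε₁ a^j₁ s ε₂ a^j₂ ⋯`. -/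
def wordProd (m n : ℕ) (L : List (ℤˣ × ℤ)) : BS m n :=
  (L.map fun p => s m n p.1 * a m n ^ p.2).prod

/-- The word contains no subword `s ε a^j s (-ε)` that can be shortened. -/
def Reduced (m n : ℕ) (L : List (ℤˣ × ℤ)) : Prop :=
  L.IsChain fun p q => (c m n (-p.1) : ℤ) ∣ p.2 → p.1 = q.1

/-- Membership in an associated subgroup implies divisibility, so a reduced word stays reduced in
the HNN extension, where Britton's lemma applies. -/
theorem eq_nil_of_wordProd_mem (hm : 1 ≤ m) (hn : 1 ≤ n) {L : List (ℤˣ × ℤ)}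
    (hL : Reduced m n L) (h : wordProd m n L ∈ Subgroup.zpowers (a m n)) : L = [] := by
  obtain ⟨A, B, φ, f, ha, ht, hd⟩ := exists_hom_HNNExtension hm hn
  let w : HNNExtension.NormalWord.ReducedWord (Multiplicative ℤ) A B :=
    { head := 1
      toList := L.map fun p => (p.1, Multiplicative.ofAdd p.2)
      chain := by
        rw [List.isChain_map]
        exact hL.imp fun p q hpq h => hpq (hd _ _ h) }
  have hw : w.prod φ = f (wordProd m n L) := by
    simp only [HNNExtension.NormalWord.ReducedWord.prod, w, wordProd, map_one, one_mul,
      List.map_map, map_list_prod]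
    congr 1
    refine List.map_congr_left fun p _ => ?_
    simp only [Function.comp, map_mul, map_zpow, s, ha, ht]
    rw [← map_zpow, ← ofAdd_zsmul, smul_eq_mul, mul_one]
  have := HNNExtension.ReducedWord.toList_eq_nil_of_mem_of_range φ w (by
    rw [hw]
    obtain ⟨i, hi⟩ := Subgroup.mem_zpowers_iff.1 h
    exact ⟨Multiplicative.ofAdd 1 ^ i, by rw [← hi, map_zpow, map_zpow, ha]⟩)
  simpa [w] using this

theorem s_inv_mul_a_zpow_mul_s_mem (hm : 1 ≤ m) (hn : 1 ≤ n) {ε : ℤˣ} {l : ℤ}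
    (h : (s m n ε)⁻¹ * a m n ^ l * s m n ε ∈ Subgroup.zpowers (a m n)) :
    (c m n ε : ℤ) ∣ l := by
  by_contra hl
  have := eq_nil_of_wordProd_mem hm hn (L := [(-ε, l), (ε, 0)])
    (by simpa [Reduced] using fun h => absurd h hl) (by simpa [wordProd, s_neg, mul_assoc] using h)
  simp at this

/-! ### Acyclicity -/

theorem wordProd_append (L M : List (ℤˣ × ℤ)) :
    wordProd m n (L ++ M) = wordProd m n L * wordProd m n M := by
  simp [wordProd]

theorem wordProd_singleton (p : ℤˣ × ℤ) : wordProd m n [p] = s m n p.1 * a m n ^ p.2 := by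
  simp [wordProd]

/-- The vertices represented by a reduced word starting with `s ε`. -/
def branch (m n : ℕ) (ε : ℤˣ) : Set (Vertex m n) :=
  {x | ∃ L, Reduced m n L ∧ L.head?.map Prod.fst = some ε ∧ x = (wordProd m n L : Vertex m n)}

theorem one_notMem_branch (hm : 1 ≤ m) (hn : 1 ≤ n) (ε : ℤˣ) :
    ((1 : BS m n) : Vertex m n) ∉ branch m n ε := by
  rintro ⟨L, hL, hh, h⟩
  have := eq_nil_of_wordProd_mem hm hn hL (by simpa using QuotientGroup.eq.1 h)
  subst this
  simp at hh

theorem s_mem_branch (ε : ℤˣ) : (s m n ε : Vertex m n) ∈ branch m n ε :=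
  ⟨[(ε, 0)], by simp [Reduced], rfl, by simp [wordProd]⟩

/-- Passing to a neighbour appends a letter to the reduced word or cancels its last one. The first
letter survives unless it was the only one, so the branch has a single exit edge. -/
theorem eq_of_adj_of_mem_branch {ε : ℤˣ} {x y : Vertex m n} (h : (tree m n).Adj x y)
    (hx : x ∈ branch m n ε) (hy : y ∉ branch m n ε) :
    x = (s m n ε : Vertex m n) ∧ y = ((1 : BS m n) : Vertex m n) := by
  obtain ⟨L, hL, hh, rfl⟩ := hx
  obtain ⟨i, η, rfl⟩ := adj_mk_iff.1 h
  rcases List.eq_nil_or_concat L with rfl | ⟨L', ⟨δ, j⟩, rfl⟩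
  · simp at hh
  rw [List.concat_eq_append] at hL hh hy ⊢
  have hL' := List.isChain_append.1 hL
  have hM : Reduced m n (L' ++ [(δ, j + i)]) := by
    refine List.isChain_append.2 ⟨hL'.1, by simp, fun p hp q hq => ?_⟩
    simp only [List.head?_cons, Option.mem_some_iff] at hq
    subst hq
    exact hL'.2.2 p hp (δ, j) (by simp)
  have hhM : (L' ++ [(δ, j + i)]).head?.map Prod.fst = some ε := by
    cases L' <;> simpa using hh
  have hprod : wordProd m n (L' ++ [(δ, j)]) * a m n ^ i = wordProd m n (L' ++ [(δ, j + i)]) := by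
    simp only [wordProd_append, wordProd_singleton, zpow_add, mul_assoc]
  rw [hprod] at hy ⊢
  -- This is exactly the case in which the new letter cancels the last one.
  by_cases hc : (c m n (-δ) : ℤ) ∣ j + i ∧ δ ≠ η
  · obtain ⟨⟨q, hq⟩, hne⟩ := hc
    have hη : η = -δ := by
      rcases Int.units_eq_one_or δ with rfl | rfl <;> rcases Int.units_eq_one_or η with rfl | rfl <;>
        simp_all
    have e : wordProd m n (L' ++ [(δ, j + i)]) * s m n η =
        wordProd m n L' * a m n ^ ((c m n δ : ℤ) * q) := by
      have := s_inv_mul_a_zpow_mul_s (m := m) (n := n) (-δ) q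
      rw [neg_neg] at this
      rw [wordProd_append, wordProd_singleton, hq, hη, ← this]
      simp only [s_neg, inv_inv, mul_assoc]
    rw [e, mk_mul_a_zpow] at hy ⊢
    rcases eq_or_ne L' [] with rfl | hne'
    · have : δ = ε := by simpa using hh
      subst this
      exact ⟨by simp [wordProd_singleton], rfl⟩
    · refine absurd ⟨L', hL'.1, ?_, rfl⟩ hy
      cases L' with
      | nil => exact absurd rfl hne'
      | cons p L' => simpa using hh
  · refine absurd ⟨(L' ++ [(δ, j + i)]) ++ [(η, 0)], ?_, ?_, ?_⟩ hy
    · refine List.isChain_append.2 ⟨hM, by simp, fun p hp q hq => ?_⟩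
      simp only [List.getLast?_append_cons, List.getLast?_singleton, List.head?_cons,
        Option.mem_some_iff] at hp hq
      subst hp hq
      intro hdvd
      by_contra hne
      exact hc ⟨hdvd, hne⟩
    · rw [List.head?_append_of_ne_nil _ (by simp)]
      exact hhM
    · rw [wordProd_append _ [(η, 0)], wordProd_singleton, zpow_zero, mul_one]

/-- After translation the edge joins `⟨a⟩` to `s ε ⟨a⟩`. A walk from the latter avoiding this edge
cannot leave the branch, which does not contain `⟨a⟩`. -/
theorem tree_isTree (hm : 1 ≤ m) (hn : 1 ≤ n) : (tree m n).IsTree := by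
  refine ⟨tree_connected, SimpleGraph.isAcyclic_iff_forall_adj_isBridge.2 fun v w h hr => ?_⟩
  obtain ⟨g, ε, rfl, rfl⟩ := adj_iff.1 h
  have h1 := TreeAut.apply_mem_semitree (action m n g⁻¹) (SimpleGraph.Reachable.symm hr)
  simp only [action_mk, inv_mul_cancel, inv_mul_cancel_left] at h1
  refine one_notMem_branch hm hn ε (TreeAut.semitree_induction (P := (· ∈ branch m n ε))
    (s_mem_branch ε) (fun x y _ _ hxy hne hx => ?_) h1)
  by_contra hy
  obtain ⟨rfl, rfl⟩ := eq_of_adj_of_mem_branch hxy hx hy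
  exact hne Sym2.eq_swap

end BaumslagSolitar

/-! Fixators in `BS(m,n)` and the main theorem. -/

namespace BaumslagSolitar

open TreeAut

variable {m n : ℕ}

/-! ### Exponents and fixed balls -/

theorem conj_a_zpow_fixes (g : BS m n) (l : ℤ) :
    action m n (g * a m n ^ l * g⁻¹) (g : Vertex m n) = g := by
  rw [action_mk, inv_mul_cancel_right, mk_mul_a_zpow]

/-- Transport of the exponent along an edge: seen from the neighbour, the factor `c m n ε` becomes
`c m n (-ε)`. -/
theorem conj_a_zpow_eq_conj (g : BS m n) (i j : ℤ) (ε : ℤˣ) :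
    g * a m n ^ ((c m n ε : ℤ) * j) * g⁻¹ =
      (g * a m n ^ i * s m n ε) * a m n ^ ((c m n (-ε) : ℤ) * j) *
        (g * a m n ^ i * s m n ε)⁻¹ := by
  rw [← s_inv_mul_a_zpow_mul_s]
  group

theorem dvd_of_conj_a_zpow_fixes (hm : 1 ≤ m) (hn : 1 ≤ n) {g : BS m n} {l : ℤ} {ε : ℤˣ}
    (h : action m n (g * a m n ^ l * g⁻¹) ((g * s m n ε : BS m n) : Vertex m n) =
      ((g * s m n ε : BS m n) : Vertex m n)) : (c m n ε : ℤ) ∣ l := by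
  refine s_inv_mul_a_zpow_mul_s_mem hm hn ?_
  rw [action_mk, eq_comm, QuotientGroup.eq] at h
  convert h using 1
  group

/-- Each step of a walk consumes one factor `m` or `n`, so one factor `mn` pays for a step in either
direction. -/
theorem conj_a_zpow_fixes_ball {R : ℕ} {l : ℤ} (hl : ((m * n : ℕ) : ℤ) ^ R ∣ l) (g : BS m n)
    {u : Vertex m n} (hu : u ∈ ball (tree m n) (g : Vertex m n) R) :
    action m n (g * a m n ^ l * g⁻¹) u = u := by
  obtain ⟨p, hp⟩ := hu
  generalize hx : (g : Vertex m n) = x at p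
  induction p generalizing R l g with
  | nil => rw [← hx, conj_a_zpow_fixes]
  | @cons x y z hxy p ih =>
    subst hx
    rw [SimpleGraph.Walk.length_cons] at hp
    obtain ⟨R, rfl⟩ : ∃ R', R = R' + 1 := ⟨R - 1, by omega⟩
    obtain ⟨i, ε, hy⟩ := adj_mk_iff.1 hxy
    obtain ⟨q, rfl⟩ := hl
    have e : ((m * n : ℕ) : ℤ) ^ (R + 1) * q =
        c m n ε * (c m n (-ε) * (((m * n : ℕ) : ℤ) ^ R * q)) := by
      rw [pow_succ, ← c_mul_c_neg ε]
      push_cast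
      ring
    rw [e, conj_a_zpow_eq_conj g i]
    exact ih (R := R) ⟨c m n (-ε) * (c m n (-ε) * q), by ring⟩ _ hy.symm (by omega)

/-- Fixing the first edge gives `l = c ε * j`, and the exponent at the next vertex is `c (-ε) * j`.
Coprimality removes `c (-ε)`, so the induction hypothesis bears on `j` itself. -/
theorem pow_dvd_of_conj_a_zpow_fixes (hm : 1 ≤ m) (hn : 1 ≤ n) (hmn : m.Coprime n) (ε : ℤˣ)
    {R : ℕ} {l : ℤ} (g : BS m n)
    (h : ∀ i ≤ R, action m n (g * a m n ^ l * g⁻¹) ((g * s m n ε ^ i : BS m n) : Vertex m n) =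
      ((g * s m n ε ^ i : BS m n) : Vertex m n)) : (c m n ε : ℤ) ^ R ∣ l := by
  induction R generalizing g l with
  | zero => simp
  | succ R ih =>
    obtain ⟨j, rfl⟩ := dvd_of_conj_a_zpow_fixes hm hn (by simpa using h 1 (by omega))
    rw [pow_succ']
    refine mul_dvd_mul_left _ ?_
    have hco : IsCoprime ((c m n ε : ℤ) ^ R) (c m n (-ε) : ℤ) :=
      ((coprime_c hmn ε).isCoprime).pow_left
    refine hco.dvd_of_dvd_mul_left (ih (g * s m n ε) fun i hi => ?_)
    have := h (i + 1) (by omega)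
    rw [conj_a_zpow_eq_conj g 0, zpow_zero, mul_one, pow_succ', ← mul_assoc] at this
    exact this

theorem mul_s_pow_mem_ball (g : BS m n) (ε : ℤˣ) (i : ℕ) :
    ((g * s m n ε ^ i : BS m n) : Vertex m n) ∈ ball (tree m n) (g : Vertex m n) i := by
  induction i with
  | zero => simpa using self_mem_ball _ _
  | succ i ih =>
    obtain ⟨p, hp⟩ := ih
    have := adj_mul_s (g * s m n ε ^ i) ε
    rw [mul_assoc, ← pow_succ] at this
    exact ⟨p.concat this, by simpa using hp⟩

theorem height_mul_s_pow (g : BS m n) (ε : ℤˣ) (i : ℕ) :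
    height m n (g * s m n ε ^ i) = height m n g * Multiplicative.ofAdd (i * (ε : ℤ)) := by
  rw [map_mul, map_pow, height_s, ← ofAdd_nsmul, nsmul_eq_mul]

/-- Height is strictly monotone along the ray, so the ray never returns to `g⟨a⟩` and can use the
removed edge only in its first step. -/
theorem mul_s_pow_mem_semitree {v : Vertex m n} {g : BS m n} {ε : ℤˣ}
    (hne : ((g * s m n ε : BS m n) : Vertex m n) ≠ v) (i : ℕ) :
    ((g * s m n ε ^ i : BS m n) : Vertex m n) ∈ semitree (tree m n) v (g : Vertex m n) := by
  have hh : ∀ i : ℕ, ((g * s m n ε ^ i : BS m n) : Vertex m n) = g → i = 0 := by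
    intro i hi
    have := height_eq_of_mk_eq hi
    rw [height_mul_s_pow, mul_eq_left, ofAdd_eq_one] at this
    simpa using this
  induction i with
  | zero => simpa using end_mem_semitree _ _
  | succ i ih =>
    have hadj := adj_mul_s (g * s m n ε ^ i) ε
    rw [mul_assoc, ← pow_succ] at hadj
    refine mem_semitree_of_adj ih hadj fun he => ?_
    rcases Sym2.eq_iff.1 he with ⟨-, h2⟩ | ⟨h1, h2⟩
    · exact absurd (hh _ h2) (by omega)
    · have := hh _ h1
      subst this
      exact hne (by simpa using h2)

theorem mk_mul_s_ne (hm : 1 ≤ m) (hn : 1 ≤ n) {ε : ℤˣ} (hc : 2 ≤ c m n ε) (g : BS m n) :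
    ((g * s m n ε : BS m n) : Vertex m n) ≠ ((g * a m n * s m n ε : BS m n) : Vertex m n) := by
  intro h
  have : (c m n ε : ℤ) ∣ 1 := dvd_of_conj_a_zpow_fixes hm hn (g := g) (by
    rw [zpow_one, action_mk, h]
    congr 1
    group)
  have := Int.le_of_dvd one_pos this
  omega

/-- The rigidity of `G`. The element is `g a^l g⁻¹`, and for each direction with `c m n ε ≥ 2` some
ray from `w` stays in the half-tree, giving `c m n ε ^ R ∣ l`. By coprimality `(mn)^R ∣ l`. -/
theorem fixes_ball_of_fixes_semitree (hm : 1 ≤ m) (hn : 1 ≤ n) (hmn : m.Coprime n)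
    {x : tree m n ≃g tree m n} (hx : x ∈ autGroup m n) {v w : Vertex m n} {R : ℕ}
    (h : ∀ u ∈ semitree (tree m n) v w, u ∈ ball (tree m n) w R → x u = u) :
    ∀ u ∈ ball (tree m n) w R, x u = u := by
  obtain ⟨b, rfl⟩ := hx
  have hw := h w (end_mem_semitree _ _) (self_mem_ball _ _)
  induction w using QuotientGroup.induction_on with | H g
  obtain ⟨l, hl⟩ : ∃ l : ℤ, g * a m n ^ l * g⁻¹ = b := by
    rw [action_mk, eq_comm, QuotientGroup.eq] at hw
    obtain ⟨l, hl⟩ := Subgroup.mem_zpowers_iff.1 hw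
    exact ⟨l, by rw [hl]; group⟩
  subst hl
  have hdvd : ∀ ε, (c m n ε : ℤ) ^ R ∣ l := by
    intro ε
    rcases Nat.lt_or_ge (c m n ε) 2 with hc | hc
    · have : c m n ε = 1 := by have := c_pos hm hn ε; omega
      simp [this]
    have key : ∀ g' : BS m n, (g' : Vertex m n) = g →
        g' * a m n ^ l * g'⁻¹ = g * a m n ^ l * g⁻¹ →
        ((g' * s m n ε : BS m n) : Vertex m n) ≠ v → (c m n ε : ℤ) ^ R ∣ l := by
      intro g' hg' hconj hne
      refine pow_dvd_of_conj_a_zpow_fixes hm hn hmn ε g' fun i hi => ?_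
      rw [hconj]
      refine h _ ?_ (ball_mono _ hi ?_)
      · rw [← hg']
        exact mul_s_pow_mem_semitree hne i
      · rw [← hg']
        exact mul_s_pow_mem_ball g' ε i
    -- The neighbours through `g` and through `g * a` differ, so at most one of them is `v`.
    by_cases hv : ((g * s m n ε : BS m n) : Vertex m n) = v
    · refine key (g * a m n) (by simp) (by group) ?_
      rw [← hv]
      exact (mk_mul_s_ne hm hn hc g).symm
    · exact key g rfl rfl hv
  have hl : ((m * n : ℕ) : ℤ) ^ R ∣ l := by
    have hco : IsCoprime ((m : ℤ) ^ R) ((n : ℤ) ^ R) := (hmn.isCoprime).pow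
    push_cast
    rw [mul_pow]
    exact hco.mul_dvd (by simpa only [c_neg_one] using hdvd (-1)) (by simpa only [c_one] using hdvd 1)
  exact fun u hu => conj_a_zpow_fixes_ball hl g hu

theorem eq_one_of_fixes_semitree (hm : 1 ≤ m) (hn : 1 ≤ n) (hmn : m.Coprime n)
    {x : tree m n ≃g tree m n} (hx : x ∈ autGroup m n) {v w : Vertex m n}
    (h : ∀ u ∈ semitree (tree m n) v w, x u = u) : x = 1 := by
  refine RelIso.ext fun u => ?_
  obtain ⟨R, hR⟩ := exists_mem_ball tree_connected w u
  exact fixes_ball_of_fixes_semitree hm hn hmn hx (fun u hu _ => h u hu) u hR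

/-! ### Failure of Property `P^(k)` -/

theorem action_a_zpow_ne_one (hm : 1 ≤ m) (hn : 1 ≤ n) (hmn : m.Coprime n)
    (hne : ¬ (m = 1 ∧ n = 1)) {l : ℤ} (hl : l ≠ 0) : action m n (a m n ^ l) ≠ 1 := by
  intro h
  obtain ⟨ε, hε⟩ : ∃ ε, 2 ≤ c m n ε := by
    by_contra! hc
    have h1 := hc 1
    have h2 := hc (-1)
    rw [c_one] at h1
    rw [c_neg_one] at h2
    omega
  have hd : ∀ R : ℕ, (c m n ε : ℤ) ^ R ∣ l := fun R =>
    pow_dvd_of_conj_a_zpow_fixes hm hn hmn ε 1 fun i _ => by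
      rw [one_mul, inv_one, mul_one, h, RelIso.one_apply]
  -- The choice `R = |l|` contradicts `|l| < c ^ |l|`.
  have := Int.natAbs_dvd_natAbs.2 (hd l.natAbs)
  rw [Int.natAbs_pow, Int.natAbs_natCast] at this
  exact absurd (Nat.le_of_dvd (Int.natAbs_pos.2 hl) this)
    (not_le.2 (Nat.lt_pow_self hε))

theorem action_a_zpow_mem_edgeFixator (k : ℕ) (w : Vertex m n) :
    action m n (a m n ^ (((m * n : ℕ) : ℤ) ^ k)) ∈
      edgeFixator (autGroup m n) k ((1 : BS m n) : Vertex m n) w := by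
  refine ⟨⟨_, rfl⟩, fun u hu => ?_⟩
  simpa using conj_a_zpow_fixes_ball dvd_rfl (1 : BS m n) hu.1

theorem mul_pow_ne_zero (hm : 1 ≤ m) (hn : 1 ≤ n) (k : ℕ) : ((m * n : ℕ) : ℤ) ^ k ≠ 0 :=
  pow_ne_zero _ (by exact_mod_cast (Nat.mul_pos hm hn).ne')

theorem not_propertyP (hm : 1 ≤ m) (hn : 1 ≤ n) (hmn : m.Coprime n) (hne : ¬ (m = 1 ∧ n = 1))
    (k : ℕ) : ¬ PropertyP (autGroup m n) k := by
  intro hP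
  have hg := action_a_zpow_mem_edgeFixator (m := m) (n := n) k ((1 * s m n 1 : BS m n) : Vertex m n)
  rw [← SetLike.mem_coe, hP _ _ (adj_mul_s 1 1)] at hg
  obtain ⟨x, hx, y, hy, hxy⟩ := hg
  have hx1 := eq_one_of_fixes_semitree hm hn hmn hx.1.1 hx.2
  have hy1 := eq_one_of_fixes_semitree hm hn hmn hy.1.1 hy.2
  subst hx1 hy1
  exact action_a_zpow_ne_one hm hn hmn hne (mul_pow_ne_zero hm hn k) (by rw [← hxy]; simp)

/-! ### Infinitely many non-discrete groups -/

/-- In the `k`-closure, which has `P^(k)`, the nontrivial element `a^((mn)^k)` splits into two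
factors that each fix a half-tree; they cannot both be trivial. -/
theorem exists_mem_closurePlus_fixing_semitree (hm : 1 ≤ m) (hn : 1 ≤ n) (hmn : m.Coprime n)
    (hne : ¬ (m = 1 ∧ n = 1)) {k : ℕ} (hk : 1 ≤ k) :
    ∃ x ∈ closurePlus m n k, x ≠ 1 ∧ ∃ v w, ∀ u ∈ semitree (tree m n) v w, x u = u := by
  have hadj := adj_mul_s (1 : BS m n) 1
  have hg := edgeFixator_mono (le_kClosure (autGroup m n) k) k _ _
    (action_a_zpow_mem_edgeFixator (m := m) (n := n) k ((1 * s m n 1 : BS m n) : Vertex m n))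
  rw [← SetLike.mem_coe, propertyP_of_kClosure_le (tree_isTree hm hn) hk
    (kClosure_kClosure_le _ k) _ _ hadj] at hg
  obtain ⟨x, hx, y, hy, hxy⟩ := hg
  by_cases hx1 : x = 1
  · refine ⟨y, mem_plus_of_mem_edgeFixator hadj hy.1, ?_, _, _, hy.2⟩
    rintro rfl
    subst hx1
    exact action_a_zpow_ne_one hm hn hmn hne (mul_pow_ne_zero hm hn k) (by rw [← hxy]; simp)
  · exact ⟨x, mem_plus_of_mem_edgeFixator hadj hx.1, hx1, _, _, hx.2⟩

theorem exists_closurePlus_lt (hm : 1 ≤ m) (hn : 1 ≤ n) (hmn : m.Coprime n)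
    (hne : ¬ (m = 1 ∧ n = 1)) {k : ℕ} (hk : 1 ≤ k) :
    ∃ l, 1 ≤ l ∧ closurePlus m n l < closurePlus m n k := by
  obtain ⟨x, hx, hx1, v, w, hfix⟩ := exists_mem_closurePlus_fixing_semitree hm hn hmn hne hk
  obtain ⟨u, hu⟩ : ∃ u, x u ≠ u := by
    by_contra! h
    exact hx1 (RelIso.ext h)
  obtain ⟨R, hR⟩ := exists_mem_ball tree_connected w u
  -- Radius `R` reaches the moved vertex `u`, so rigidity rules out local agreement with `G`; the
  -- extra `k` makes the new index at least `k`.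
  have hxR : x ∉ kClosure (autGroup m n) (R + k) := by
    intro hx
    obtain ⟨g, hg, hgx⟩ := hx w
    have hR' := ball_mono w (by omega : R ≤ R + k) hR
    refine hu ?_
    rw [← hgx u hR']
    refine fixes_ball_of_fixes_semitree hm hn hmn hg (v := v) (fun z hz hzR => ?_) u hR'
    rw [hgx z hzR, hfix z hz]
  refine ⟨R + k, by omega, lt_of_le_of_ne (plus_kClosure_anti _ (by omega)) fun h => hxR ?_⟩
  rw [← h] at hx
  exact plus_le _ _ hx

theorem infinite_closurePlus (hm : 1 ≤ m) (hn : 1 ≤ n) (hmn : m.Coprime n)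
    (hne : ¬ (m = 1 ∧ n = 1)) :
    {H | ∃ k : ℕ, 1 ≤ k ∧ H = closurePlus m n k}.Infinite := by
  intro hfin
  obtain ⟨_, ⟨k, hk, rfl⟩, hmin⟩ := hfin.exists_minimal ⟨_, 1, le_rfl, rfl⟩
  obtain ⟨l, hl, hlt⟩ := exists_closurePlus_lt hm hn hmn hne hk
  exact hlt.not_ge (hmin ⟨l, hl, rfl⟩ hlt.le)

theorem not_discreteTopology_closurePlus (hm : 1 ≤ m) (hn : 1 ≤ n) (hmn : m.Coprime n)
    (hne : ¬ (m = 1 ∧ n = 1)) (k : ℕ) : ¬ DiscreteTopology (closurePlus m n k) := by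
  intro hd
  obtain ⟨U, hU, hU1⟩ := isOpen_induced_iff.1 (isOpen_discrete ({1} : Set (closurePlus m n k)))
  have h1 : (1 : tree m n ≃g tree m n) ∈ U := by
    have : (1 : closurePlus m n k) ∈ Subtype.val ⁻¹' U := by rw [hU1]; rfl
    exact this
  obtain ⟨F, hF⟩ := exists_finset_of_isOpen hU h1
  obtain ⟨R, hR⟩ := exists_finset_subset_ball tree_connected ((1 : BS m n) : Vertex m n) F
  -- The second vertex is taken equal to the first, so the intersection is the full ball. Radius at
  -- least `R` covers `F`, and radius at least `k` gives membership in `F_{k,e}`.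
  have hfix := action_a_zpow_mem_edgeFixator (m := m) (n := n) (R + k)
    ((1 : BS m n) : Vertex m n)
  set x := action m n (a m n ^ (((m * n : ℕ) : ℤ) ^ (R + k))) with hx
  have hxk : x ∈ closurePlus m n k := by
    refine mem_plus_of_mem_edgeFixator (adj_mul_s (1 : BS m n) 1)
      ⟨le_kClosure _ _ hfix.1, fun u hu => hfix.2 u ?_⟩
    rw [Set.inter_self]
    exact ball_mono _ (by omega) hu.1
  have hxU : (⟨x, hxk⟩ : closurePlus m n k) ∈ Subtype.val ⁻¹' U := by
    refine hF x fun v hv => hfix.2 v ?_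
    rw [Set.inter_self]
    exact ball_mono _ (by omega) (hR v hv)
  rw [hU1] at hxU
  exact action_a_zpow_ne_one hm hn hmn hne (mul_pow_ne_zero hm hn (R + k))
    (congrArg Subtype.val hxU)

/-! ### Displacing half-trees, and simplicity -/

theorem threeNeighbors_tree (hm : 1 ≤ m) (hn : 2 ≤ n) : ThreeNeighbors (tree m n) := by
  intro u
  induction u using QuotientGroup.induction_on with | H g
  have hht : ∀ b : BS m n, height m n (b * s m n 1) = height m n (g * s m n (-1)) →
      height m n b ≠ height m n g := by
    intro b h1 h2
    rw [map_mul, map_mul, h2, height_s, height_s, mul_right_inj] at h1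
    exact absurd (Multiplicative.ofAdd.injective h1) (by decide)
  refine ⟨((g * s m n 1 : BS m n) : Vertex m n), ((g * a m n * s m n 1 : BS m n) : Vertex m n),
    ((g * s m n (-1) : BS m n) : Vertex m n), adj_mul_s g 1, adj_mk_iff.2 ⟨1, 1, by rw [zpow_one]⟩,
    adj_mul_s g (-1), mk_mul_s_ne hm (by omega) (ε := 1) hn g,
    fun h => hht _ (height_eq_of_mk_eq h) rfl, fun h => hht _ (height_eq_of_mk_eq h) ?_⟩
  rw [map_mul, height_a, mul_one]

/-- Going `k` steps in direction `-ε` trades `k` of the `2k` factors `c (-ε)` for factors `c ε`,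
leaving `(mn)^k`. Thus an exponent coprime to `c ε` still yields an element fixing some ball of
radius `k`. -/
theorem conj_a_zpow_eq_conj_s_pow (g : BS m n) (ε : ℤˣ) (k : ℕ) :
    ∃ b : BS m n, g * a m n ^ ((c m n (-ε) : ℤ) ^ (2 * k)) * g⁻¹ =
      b * a m n ^ (((m * n : ℕ) : ℤ) ^ k) * b⁻¹ := by
  suffices h : ∀ (i : ℕ) (q : ℤ), ∃ b : BS m n,
      g * a m n ^ ((c m n (-ε) : ℤ) ^ i * q) * g⁻¹ =
        b * a m n ^ ((c m n ε : ℤ) ^ i * q) * b⁻¹ by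
    obtain ⟨b, hb⟩ := h k ((c m n (-ε) : ℤ) ^ k)
    refine ⟨b, ?_⟩
    rw [two_mul, pow_add, hb, ← c_mul_c_neg ε, Nat.cast_mul, mul_pow]
  intro i
  induction i with
  | zero => exact fun q => ⟨g, by simp⟩
  | succ i ih =>
    intro q
    obtain ⟨b, hb⟩ := ih (c m n (-ε) * q)
    refine ⟨b * s m n (-ε), ?_⟩
    have := conj_a_zpow_eq_conj b 0 ((c m n ε : ℤ) ^ i * q) (-ε)
    rw [neg_neg, zpow_zero, mul_one] at this
    rw [pow_succ, mul_assoc (_ ^ i), hb, pow_succ', mul_assoc (c m n ε : ℤ), ← this, mul_left_comm]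

/-- The element of `conj_a_zpow_eq_conj_s_pow` fixes a ball of radius `k` elsewhere, so it lies in
the group. It fixes `g⟨a⟩` but moves the neighbour in direction `ε`, because `c ε ≥ 2` is coprime to
the exponent; the half-tree goes to another branch at `g⟨a⟩`. -/
theorem exists_mem_closurePlus_displacing (hm : 2 ≤ m) (hn : 2 ≤ n) (hmn : m.Coprime n) (k : ℕ)
    {v w : Vertex m n} (h : (tree m n).Adj v w) :
    ∃ x ∈ closurePlus m n k,
      ∀ u ∈ semitree (tree m n) v w, x u ∉ semitree (tree m n) v w := by
  obtain ⟨g, ε, rfl, rfl⟩ := adj_iff.1 h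
  obtain ⟨b, hb⟩ := conj_a_zpow_eq_conj_s_pow g ε k
  set x := action m n (g * a m n ^ ((c m n (-ε) : ℤ) ^ (2 * k)) * g⁻¹) with hx
  have hxg : x (g : Vertex m n) = g := conj_a_zpow_fixes g _
  have hne : x ((g * s m n ε : BS m n) : Vertex m n) ≠ ((g * s m n ε : BS m n) : Vertex m n) := by
    intro he
    have hd := dvd_of_conj_a_zpow_fixes (by omega) (by omega) he
    have hco : (c m n ε).Coprime (c m n (-ε) ^ (2 * k)) := (coprime_c hmn ε).pow_right _
    have h1 := Nat.eq_one_of_dvd_coprimes hco dvd_rfl (by exact_mod_cast hd)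
    rcases Int.units_eq_one_or ε with rfl | rfl
    · rw [c_one] at h1; omega
    · rw [c_neg_one] at h1; omega
  refine ⟨x, mem_plus_of_mem_edgeFixator (adj_mul_s b 1)
    ⟨le_kClosure _ _ ⟨_, rfl⟩, fun u hu => ?_⟩, fun u hu => ?_⟩
  · rw [hx, hb]
    exact conj_a_zpow_fixes_ball dvd_rfl b hu.1
  · have hu' := apply_mem_semitree x hu
    have hadj := x.map_rel_iff.2 h
    rw [hxg] at hu' hadj
    exact notMem_semitree_of_ne (tree_isTree (by omega) (by omega)) hadj h hne hu'

theorem isSimpleGroup_closurePlus (hm : 2 ≤ m) (hn : 2 ≤ n) (hmn : m.Coprime n) {k : ℕ}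
    (hk : 1 ≤ k) : IsSimpleGroup (closurePlus m n k) :=
  isSimpleGroup_plus (tree_isTree (by omega) (by omega)) (threeNeighbors_tree (by omega) hn) hk
    (kClosure_kClosure_le _ k) fun _ _ h => exists_mem_closurePlus_displacing hm hn hmn k h

end BaumslagSolitar

theorem mainTheorem10 (m n : ℕ) (hm : 1 ≤ m) (hn : 1 ≤ n) (hmn : Nat.Coprime m n)
    (hne : ¬ (m = 1 ∧ n = 1)) :
    (∀ k : ℕ, ¬ TreeAut.PropertyP (BaumslagSolitar.autGroup m n) k) ∧
    {H | ∃ k : ℕ, 1 ≤ k ∧ H = BaumslagSolitar.closurePlus m n k}.Infinite ∧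
    (∀ k : ℕ, 1 ≤ k → ¬ DiscreteTopology (BaumslagSolitar.closurePlus m n k)) ∧
    (2 ≤ m → 2 ≤ n → ∀ k : ℕ, 1 ≤ k →
      IsSimpleGroup (BaumslagSolitar.closurePlus m n k)) :=
  ⟨BaumslagSolitar.not_propertyP hm hn hmn hne,
    BaumslagSolitar.infinite_closurePlus hm hn hmn hne,
    fun k _ => BaumslagSolitar.not_discreteTopology_closurePlus hm hn hmn hne k,
    fun hm hn _ hk => BaumslagSolitar.isSimpleGroup_closurePlus hm hn hmn hk⟩
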